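/- **Theorem ($H(\mathrm{div},A)$-conformity of the template-based Brezzi-Douglas-Marini triangle).** *Setting.* Let $\Gamma=\{(\xi,\eta)\in[0,1]^2 : \xi+\eta\le 1\}$ with vertices $v_1=(0,0)$, $v_2=(0,1)$, $v_3=(1,0)$ and edges $e_{ij}$, $(i,j)\in\mathcal J=\{(1,2),(1,3),(2,3)\}$. Put $\tau_{ij}=v_j-v_i$ and $\nu_{ij}=R\,\tau_{ij}$, $R=\begin{bmatrix}0&1\\-1&0\end{bmatrix}$ (the normal of $e_{ij}$, scaled by the length of the edge). Let $p\ge 1$ and let $U^p$ be a polynomial $H^1$-conforming basis on $\Gamma$: $\dim P^p(\Gamma)=(p+1)(p+2)/2$ linearly independent polynomials, namely one for each vertex (vanishing on the opposite edge), $p-1$ for each edge (vanishing on the two other edges) and $(p-1)(p-2)/2$ for the cell (vanishing on $\partial\Gamma$), such that the traces of corresponding functions agree whenever an edge $e_{ij}$ of one element is glued to an edge $e_{i'j'}$ of another one by $v_i+t\tau_{ij}\leftrightarrow v_{i'}+t\tau_{i'j'}$, $t\in[0,1]$: the vertex functions of $v_i,v_{i'}$, those of $v_j,v_{j'}$, and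 the $k$-th edge functions. With the template sets $$\mathcal T_1=\{e_1,-e_2\},\quad \mathcal T_2=\{e_1-e_2,-e_2\},\quad \mathcal T_3=\{e_1-e_2,-e_1\},$$ $$\mathcal T_{12}=\{e_1,e_2\},\quad \mathcal T_{13}=\{-e_2,e_1\},\quad \mathcal T_{23}=\{-\tfrac12(e_1+e_2),\,e_2-e_1\},\quad \mathcal T_{123}=\{e_1,e_2\},$$ the base functions of $\mathcal{BDM}^p$ are the products $\phi=n\,\ell$ of each base function $n$ of $U^p$ with both vectors $\ell$ of the template set of its polytope. Such a $\phi$ is a base function *of the edge* $e_{ij}$ if $n$ belongs to $e_{ij}$, $v_i$ or $v_j$ and $\langle\nu_{ij},\ell\rangle\neq0$; it is a *cell* base function if $n$ belongs to the cell, or $n$ belongs to an edge $e_{ij}$ and $\langle\nu_{ij},\ell\rangle=0$. Let $A\subset\mathbb R^2$ be open with $\overline A=\bigcup_K x_K(\Gamma)$ a finite conforming mesh: each $x_K$ is (the restriction to $\Gamma$ of) a $C^1$ map $\mathbb R^2\to\mathbb R^2$, injective on $\Gamma$, with $J_K=Dx_K$ invertible on $\Gamma$; the mesh vertices are numbered,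 and the local vertex order in each element is increasing in these numbers; two different elements meet only in common vertices and common edges; and a common edge has the same parametrization $t\mapsto x_K(v_i+t\tau_{ij})=x_L(v_{i'}+t\tau_{i'j'})$ from both sides. The contravariant Piola transform of $\phi$ is $\varphi(x_K(\xi))=\frac{1}{\det J_K(\xi)}J_K(\xi)\phi(\xi)$. The finite element space on the mesh consists of the vector fields which on each element are the Piola transform of an element of $\mathcal{BDM}^p$, such that the coefficients of corresponding base functions of a common edge agree in the elements sharing this edge (coefficients of cell base functions being free). *Claim.* 1. Every non-cell base function $\phi=n\,\ell$ is a base function of exactly one edge $e_{ij}$; on this edge $\langle\nu_{ij},\phi\rangle=n$, and its normal projection vanishes on the two other edges. The normal projections of cell base functions vanish on all edges. 2. The contravariant Piola transformation maintains these projections: for each element $K$, each base function $\phi$ with Piola transform $\varphi$, and each edge $e_{ij}$, $\langle R J_K\tau_{ij},\,\varphi\circ x_K\rangle=\langle\nu_{ij},\phi\rangle$ on $e_{ij}$. 3. For every function of the finite element space the normal component does not jump across the interfaces: at each point of a common edge of two elements and for each vector normal to the edge there, the normal components of the two element-wise fields agree. 4. The finite element space is contained in $H(\mathrm{div},A)$,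 i.e. its fields are in $[L^2(A)]^2$ and have a weak divergence in $L^2(A)$. -/

import Mathlib

open MeasureTheory

namespace BDMTriangle

noncomputable section

/-- The Euclidean plane. -/
abbrev E2 := EuclideanSpace ℝ (Fin 2)

/-! ### The reference triangle -/

/-- The closed reference triangle. -/
def refTriangle : Set E2 := {ξ | 0 ≤ ξ 0 ∧ 0 ≤ ξ 1 ∧ ξ 0 + ξ 1 ≤ 1}

/-- The vertices `v₁ = (0,0)`, `v₂ = (0,1)`, `v₃ = (1,0)` (indices `0, 1, 2`). -/
def refVertex : Fin 3 → E2 := ![!₂[0, 0], !₂[0, 1], !₂[1, 0]]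

/-- Edge labels: `0, 1, 2` stand for the edges `e₁₂`, `e₁₃`, `e₂₃`. -/
abbrev Edge := Fin 3

/-- The first vertex of an edge. -/
def src : Edge → Fin 3 := ![0, 0, 1]

/-- The second vertex of an edge. -/
def tgt : Edge → Fin 3 := ![1, 2, 2]

/-- The tangent vector `τ` of the edge `e_ij`, running from `v_i` to `v_j`, `i < j`. -/
def tangent (e : Edge) : E2 := refVertex (tgt e) - refVertex (src e)

/-- The rotation `R = [[0, 1], [-1, 0]]`. -/
def rot (v : E2) : E2 := !₂[v 1, -v 0]

/-- The edge normal `ν = R τ`. -/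
def normal (e : Edge) : E2 := rot (tangent e)

/-- The parametrization of the edge `e_ij` from `v_i` to `v_j`. -/
def edgePoint (e : Edge) (t : ℝ) : E2 := refVertex (src e) + t • tangent e

/-- The closed edge as a set of points. -/
def refEdge (e : Edge) : Set E2 := edgePoint e '' Set.Icc 0 1

/-! ### The underlying scalar basis -/

/-- Labels of the scalar base functions: one per vertex, `p - 1` per edge,
`(p - 1) (p - 2) / 2` in the cell. -/
abbrev ScalarIdx (p : ℕ) := Fin 3 ⊕ (Edge × Fin (p - 1)) ⊕ Fin ((p - 1) * (p - 2) / 2)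

/-- The polytope of a scalar base function lies on the edge `e`:
it is a vertex of `e`, or it is `e` itself. -/
def OnEdge {p : ℕ} (s : ScalarIdx p) (e : Edge) : Prop :=
  match s with
  | .inl i => i = src e ∨ i = tgt e
  | .inr (.inl (f, _)) => f = e
  | .inr (.inr _) => False

/-- When the edges `e` and `e'` of two elements are glued together (first vertex to first vertex,
second to second), `s` on the one element and `s'` on the other are the same function. -/
def SameOnEdge {p : ℕ} (e e' : Edge) : ScalarIdx p → ScalarIdx p → Prop
  | .inl i, .inl i' => (i = src e ∧ i' = src e') ∨ (i = tgt e ∧ i' = tgt e')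
  | .inr (.inl (f, k)), .inr (.inl (f', k')) => f = e ∧ f' = e' ∧ k = k'
  | _, _ => False

/-- A polynomial `H¹`-conforming basis `U^p` on the reference triangle: linearly independent
polynomials, `dim P^p` in number, associated with the vertices, the edges and the cell. -/
structure H1Basis (p : ℕ) where
  /-- the base functions -/
  base : ScalarIdx p → MvPolynomial (Fin 2) ℝ
  linearIndependent : LinearIndependent ℝ base
  /-- A vertex function vanishes on the opposite edge, an edge function on the two other edges,
  and a cell function on all edges. -/
  polytopal : ∀ s e, ¬ OnEdge s e → ∀ ξ ∈ refEdge e, MvPolynomial.eval (fun i => ξ i) (base s) = 0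
  /-- The interface condition of `H¹`: when two elements are glued along an edge, the traces from
  both sides of a function of that edge agree. -/
  conforming : ∀ e e' s s', SameOnEdge e e' s s' → ∀ t ∈ Set.Icc (0 : ℝ) 1,
    MvPolynomial.eval (fun i => edgePoint e t i) (base s) =
      MvPolynomial.eval (fun i => edgePoint e' t i) (base s')

/-- The scalar base function as a function on the plane. -/
def H1Basis.fn {p : ℕ} (U : H1Basis p) (s : ScalarIdx p) (ξ : E2) : ℝ :=
  MvPolynomial.eval (fun i => ξ i) (U.base s)

/-! ### The Brezzi-Douglas-Marini template and base functions -/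

/-- The template sets `T₁, T₂, T₃` of the vertices. -/
def vertexTemplate : Fin 3 → Fin 2 → E2 :=
  ![![!₂[1, 0], !₂[0, -1]], ![!₂[1, -1], !₂[0, -1]], ![!₂[1, -1], !₂[-1, 0]]]

/-- The template sets `T₁₂, T₁₃, T₂₃` of the edges. -/
def edgeTemplate : Edge → Fin 2 → E2 :=
  ![![!₂[1, 0], !₂[0, 1]], ![!₂[0, -1], !₂[1, 0]], ![!₂[-(1 / 2), -(1 / 2)], !₂[-1, 1]]]

/-- The template set `T₁₂₃` of the cell. -/
def cellTemplate : Fin 2 → E2 := ![!₂[1, 0], !₂[0, 1]]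

/-- The template set of the polytope of a scalar base function. -/
def template {p : ℕ} (s : ScalarIdx p) : Fin 2 → E2 :=
  match s with
  | .inl i => vertexTemplate i
  | .inr (.inl (e, _)) => edgeTemplate e
  | .inr (.inr _) => cellTemplate

/-- Labels of the vectorial base functions: every scalar base function is multiplied with the two
template vectors of its polytope. -/
abbrev VecIdx (p : ℕ) := ScalarIdx p × Fin 2

/-- The vectorial base function `φ = n ℓ` on the reference triangle. -/
def H1Basis.bdm {p : ℕ} (U : H1Basis p) (b : VecIdx p) (ξ : E2) : E2 :=
  U.fn b.1 ξ • template b.1 b.2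

/-- The (vertex-edge and edge) base functions of the edge `e`: the scalar function belongs to `e` or
to one of its vertices, and the template vector has a nonzero normal projection on `e`. -/
def IsEdgeFunction {p : ℕ} (b : VecIdx p) (e : Edge) : Prop :=
  OnEdge b.1 e ∧ inner ℝ (normal e) (template b.1 b.2) ≠ 0

/-- The (edge-cell and cell) cell base functions. -/
def IsCellFunction {p : ℕ} (b : VecIdx p) : Prop :=
  match b.1 with
  | .inl _ => False
  | .inr (.inl (e, _)) => inner ℝ (normal e) (template b.1 b.2) = 0
  | .inr (.inr _) => True

/-- The element of `BDM^p` with coefficients `c`. -/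
def H1Basis.field {p : ℕ} (U : H1Basis p) (c : VecIdx p → ℝ) (ξ : E2) : E2 :=
  ∑ b, c b • U.bdm b ξ

/-- The contravariant Piola transform `(det J)⁻¹ J φ`, `J = Dx`, of `φ` under the element map `x`:
the value of the transformed field at the point `x ξ`. -/
def piola (x : E2 → E2) (φ : E2 → E2) (ξ : E2) : E2 :=
  (fderiv ℝ x ξ).det⁻¹ • fderiv ℝ x ξ (φ ξ)

/-! ### Meshes, the finite element space, and `H(div)` -/

/-- A conforming mesh of the domain `A` by finitely many, possibly curved, triangles `x_K(Γ)`.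
The mesh vertices are numbered, and each element lists its vertices in increasing order. -/
structure Mesh (A : Set E2) where
  /-- the number of elements -/
  size : ℕ
  /-- the element maps `x_K` -/
  map : Fin size → E2 → E2
  /-- the numbers of the three vertices of an element -/
  vert : Fin size → Fin 3 → ℕ
  vert_strictMono : ∀ K, StrictMono (vert K)
  contDiff : ∀ K, ContDiff ℝ 1 (map K)
  injOn : ∀ K, Set.InjOn (map K) refTriangle
  det_ne_zero : ∀ K, ∀ ξ ∈ refTriangle, (fderiv ℝ (map K) ξ).det ≠ 0
  closure_eq : closure A = ⋃ K, map K '' refTriangle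
  /-- A vertex number determines the vertex. -/
  vertex_eq : ∀ K L i j, vert K i = vert L j → map K (refVertex i) = map L (refVertex j)
  /-- A common edge of two elements has the same parametrization from both sides. -/
  edge_eq : ∀ K L e e', vert K (src e) = vert L (src e') → vert K (tgt e) = vert L (tgt e') →
    ∀ t ∈ Set.Icc (0 : ℝ) 1, map K (edgePoint e t) = map L (edgePoint e' t)
  /-- Two different elements meet only in common vertices and common edges. -/
  inter : ∀ K L, K ≠ L → ∀ ξ ∈ refTriangle, ∀ ζ ∈ refTriangle, map K ξ = map L ζ →
    (∃ i j, vert K i = vert L j ∧ ξ = refVertex i ∧ ζ = refVertex j) ∨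
    (∃ e e', vert K (src e) = vert L (src e') ∧ vert K (tgt e) = vert L (tgt e') ∧
      ∃ t ∈ Set.Icc (0 : ℝ) 1, ξ = edgePoint e t ∧ ζ = edgePoint e' t)

/-- The edge `e` of the element `K` and the edge `e'` of the element `L` are the same mesh edge. -/
def Mesh.SameEdge {A : Set E2} (M : Mesh A) (K L : Fin M.size) (e e' : Edge) : Prop :=
  M.vert K (src e) = M.vert L (src e') ∧ M.vert K (tgt e) = M.vert L (tgt e')

/-- Element coefficients of a finite element function: the base functions of an edge are shared by
the elements with that edge, so their coefficients are equal there; cell functions are free. -/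
def Mesh.IsAssembled {A : Set E2} (M : Mesh A) {p : ℕ} (c : Fin M.size → VecIdx p → ℝ) : Prop :=
  ∀ K L e e', M.SameEdge K L e e' → ∀ b b' : VecIdx p, SameOnEdge e e' b.1 b'.1 →
    IsEdgeFunction b e → IsEdgeFunction b' e' → c K b = c L b'

/-- The finite element space on the mesh: on each element the vector field is the Piola transform of
an element of `BDM^p`, with shared coefficients on common edges. (No value is prescribed on the
element boundaries, which form a null set.) -/
def Mesh.bdmSpace {A : Set E2} (M : Mesh A) {p : ℕ} (U : H1Basis p) : Set (E2 → E2) :=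
  {u | ∃ c : Fin M.size → VecIdx p → ℝ, M.IsAssembled c ∧
    ∀ K, ∀ ξ ∈ interior refTriangle, u (M.map K ξ) = piola (M.map K) (U.field (c K)) ξ}

/-- `H(div, A)`: square integrable vector fields with a square integrable weak divergence `d`
(here `fderiv ℝ q x (u x) = ⟨∇q(x), u(x)⟩`). -/
def Hdiv (A : Set E2) : Set (E2 → E2) :=
  {u | MemLp u 2 (volume.restrict A) ∧ ∃ d : E2 → ℝ, MemLp d 2 (volume.restrict A) ∧
    ∀ q : E2 → ℝ, ContDiff ℝ (⊤ : ℕ∞) q → HasCompactSupport q → tsupport q ⊆ A →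
      ∫ x in A, fderiv ℝ q x (u x) = -∫ x in A, d x * q x}

end

end BDMTriangle

open BDMTriangle

namespace BDMTriangle

open Filter Topology

/-! ### Plane geometry -/

/-! Each template vector has normal projection 0 or 1 on the edges of its polytope
(`inner_template`). A base function whose scalar factor is not on an edge vanishes there. Hence the
normal trace of a field on an edge is a combination of scalar traces, with the coefficients of that
edge's base functions alone (`inner_normal_field`). Shared coefficients and the conformity of the
scalar basis make these traces agree from both sides of an interface.

The Piola transform keeps them: ⟨R v, w⟩ is the area form, a linear map J multiplies it by det J,
and the factor 1/det J undoes this (`inner_rot_map`). Since the tangents `J τ` from both sides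
coincide, physical normal components do not jump.

For `H(div)`, the candidate divergence is det J⁻¹ div φ on each cell. Change of variables and the
divergence theorem on the triangle (`Mesh.setIntegral_cell`) reduce the weak identity to boundary
integrals with signs `Mesh.side`. These cancel because an edge point inside the open domain has
exactly one element on each side (`Mesh.existsUnique_side`). This is not a mesh axiom; it follows by
moving a short way off the edge: the elements cover the closure of the domain, and their interiors
are disjoint. -/

lemma inner_eq (v w : E2) : inner ℝ v w = v 0 * w 0 + v 1 * w 1 := by
  simp [PiLp.inner_apply, Fin.sum_univ_two]; ring

@[simp] lemma rot_zero (v : E2) : rot v 0 = v 1 := rfl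

@[simp] lemma rot_one (v : E2) : rot v 1 = -v 0 := rfl

lemma e2_ext {v w : E2} (h0 : v 0 = w 0) (h1 : v 1 = w 1) : v = w := by
  ext i; fin_cases i <;> assumption

lemma inner_rot_eq (v w : E2) : inner ℝ (rot v) w = v 1 * w 0 - v 0 * w 1 := by
  rw [inner_eq]; simp; ring

lemma e2_eq_smul (v : E2) : v = v 0 • (!₂[1, 0] : E2) + v 1 • (!₂[0, 1] : E2) := by
  apply e2_ext <;> simp

lemma clm_apply (L : E2 →L[ℝ] E2) (v : E2) (i : Fin 2) :
    L v i = v 0 * L !₂[1, 0] i + v 1 * L !₂[0, 1] i := by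
  conv_lhs => rw [e2_eq_smul v]
  simp

lemma clm_det (L : E2 →L[ℝ] E2) :
    L.det = L !₂[1, 0] 0 * L !₂[0, 1] 1 - L !₂[0, 1] 0 * L !₂[1, 0] 1 := by
  have h0 : (EuclideanSpace.basisFun (Fin 2) ℝ).toBasis 0 = (!₂[1, 0] : E2) := by
    apply e2_ext <;> simp
  have h1 : (EuclideanSpace.basisFun (Fin 2) ℝ).toBasis 1 = (!₂[0, 1] : E2) := by
    apply e2_ext <;> simp
  rw [ContinuousLinearMap.det, ← LinearMap.det_toMatrix (EuclideanSpace.basisFun (Fin 2) ℝ).toBasis,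
    Matrix.det_fin_two]
  simp only [LinearMap.toMatrix_apply, h0, h1]
  simp

/-- A linear map of the plane multiplies the area form by its determinant. -/
lemma inner_rot_map (L : E2 →L[ℝ] E2) (v w : E2) :
    inner ℝ (rot (L v)) (L w) = L.det * inner ℝ (rot v) w := by
  rw [inner_rot_eq, inner_rot_eq, clm_det, clm_apply L v, clm_apply L v, clm_apply L w,
    clm_apply L w]
  ring

lemma inner_rot_map_inv_det {L : E2 →L[ℝ] E2} (hL : L.det ≠ 0) (v w : E2) :
    inner ℝ (rot (L v)) (L.det⁻¹ • L w) = inner ℝ (rot v) w := by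
  rw [inner_smul_right, inner_rot_map, inv_mul_cancel_left₀ hL]

/-- In the plane the orthogonal complement of a nonzero vector is the line spanned by its rotation;
the witness is the projection coefficient. -/
lemma eq_smul_rot_of_inner_eq_zero {v n : E2} (hv : v ≠ 0) (h : inner ℝ n v = 0) :
    ∃ a : ℝ, n = a • rot v := by
  rw [inner_eq] at h
  have hN : v 0 * v 0 + v 1 * v 1 ≠ 0 := by
    intro h0
    apply hv
    have h1 : v 0 = 0 := by nlinarith [mul_self_nonneg (v 0), mul_self_nonneg (v 1)]
    have h2 : v 1 = 0 := by nlinarith [mul_self_nonneg (v 0), mul_self_nonneg (v 1)]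
    exact e2_ext h1 h2
  refine ⟨(n 0 * v 1 - n 1 * v 0) / (v 0 * v 0 + v 1 * v 1), e2_ext ?_ ?_⟩
  · rw [PiLp.smul_apply, rot_zero, smul_eq_mul, div_mul_eq_mul_div, eq_div_iff hN]
    linear_combination v 0 * h
  · rw [PiLp.smul_apply, rot_one, smul_eq_mul, div_mul_eq_mul_div, eq_div_iff hN]
    linear_combination v 1 * h

/-! ### The reference triangle -/

@[simp] lemma tangent_zero : tangent 0 = !₂[0, 1] := by
  apply e2_ext <;> simp [tangent, src, tgt, refVertex]

@[simp] lemma tangent_one : tangent 1 = !₂[1, 0] := by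
  apply e2_ext <;> simp [tangent, src, tgt, refVertex]

@[simp] lemma tangent_two : tangent 2 = !₂[1, -1] := by
  apply e2_ext <;> simp [tangent, src, tgt, refVertex]

lemma tangent_ne_zero (e : Edge) : tangent e ≠ 0 := by
  intro h
  have h0 := congrArg (fun v : E2 => v 0) h
  have h1 := congrArg (fun v : E2 => v 1) h
  fin_cases e <;> simp_all

lemma inner_normal (e : Edge) (w : E2) :
    inner ℝ (normal e) w = tangent e 1 * w 0 - tangent e 0 * w 1 := inner_rot_eq _ _

/-- The barycentric coordinate that vanishes on the edge. -/
def bary (e : Edge) (ξ : E2) : ℝ := ![ξ 0, ξ 1, 1 - ξ 0 - ξ 1] e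

@[simp] lemma bary_zero (ξ : E2) : bary 0 ξ = ξ 0 := rfl
@[simp] lemma bary_one (ξ : E2) : bary 1 ξ = ξ 1 := rfl
@[simp] lemma bary_two (ξ : E2) : bary 2 ξ = 1 - ξ 0 - ξ 1 := rfl

/-- The orientation of the edge: `normalSign e • normal e` points outward. -/
def normalSign : Edge → ℝ := ![-1, 1, -1]

@[simp] lemma normalSign_zero : normalSign 0 = -1 := rfl
@[simp] lemma normalSign_one : normalSign 1 = 1 := rfl
@[simp] lemma normalSign_two : normalSign 2 = -1 := rfl

/-- Barycentric coordinates are affine, with the inward normal as gradient. Motion across an edge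
can thus be read off from ⟨ν, ·⟩. -/
lemma bary_sub (e : Edge) (ξ ζ : E2) :
    bary e ξ - bary e ζ = -(normalSign e * inner ℝ (normal e) (ξ - ζ)) := by
  fin_cases e <;> simp [inner_normal]
  ring

lemma edgePoint_zero (t : ℝ) : edgePoint 0 t = !₂[0, t] := by
  apply e2_ext <;> simp [edgePoint, src, refVertex]

lemma edgePoint_one (t : ℝ) : edgePoint 1 t = !₂[t, 0] := by
  apply e2_ext <;> simp [edgePoint, src, refVertex]

lemma edgePoint_two (t : ℝ) : edgePoint 2 t = !₂[t, 1 - t] := by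
  apply e2_ext <;> simp [edgePoint, src, refVertex]; ring

lemma mem_refTriangle_iff {ξ : E2} : ξ ∈ refTriangle ↔ ∀ e, 0 ≤ bary e ξ := by
  simp [Fin.forall_fin_succ, refTriangle, sub_sub]

lemma bary_edgePoint (e : Edge) (t : ℝ) : bary e (edgePoint e t) = 0 := by
  fin_cases e <;> simp [edgePoint_zero, edgePoint_one, edgePoint_two]

lemma bary_edgePoint_pos {e e' : Edge} (h : e' ≠ e) {t : ℝ} (ht : t ∈ Set.Ioo (0 : ℝ) 1) :
    0 < bary e' (edgePoint e t) := by
  obtain ⟨h0, h1⟩ := ht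
  fin_cases e <;> fin_cases e' <;>
    simp_all [edgePoint_zero, edgePoint_one, edgePoint_two]

lemma edgePoint_mem {t : ℝ} (e : Edge) (ht : t ∈ Set.Icc (0 : ℝ) 1) :
    edgePoint e t ∈ refTriangle := by
  obtain ⟨h0, h1⟩ := ht
  fin_cases e <;> simp_all [edgePoint_zero, edgePoint_one, edgePoint_two, refTriangle]

lemma refEdge_subset (e : Edge) : refEdge e ⊆ refTriangle := by
  rintro _ ⟨t, ht, rfl⟩
  exact edgePoint_mem e ht

lemma exists_bary_refVertex_eq_zero (i : Fin 3) :
    ∃ e e', e ≠ e' ∧ bary e (refVertex i) = 0 ∧ bary e' (refVertex i) = 0 := by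
  fin_cases i
  · exact ⟨0, 1, by decide, by simp [refVertex], by simp [refVertex]⟩
  · exact ⟨0, 2, by decide, by simp [refVertex], by simp [refVertex]⟩
  · exact ⟨1, 2, by decide, by simp [refVertex], by simp [refVertex]⟩

lemma continuous_bary (e : Edge) : Continuous (bary e) := by
  fin_cases e
  · exact (by fun_prop : Continuous fun ξ : E2 => ξ 0)
  · exact (by fun_prop : Continuous fun ξ : E2 => ξ 1)
  · exact (by fun_prop : Continuous fun ξ : E2 => 1 - ξ 0 - ξ 1)

/-! ### Normal projections of the base functions -/

section normalProjection

variable {p : ℕ} (U : H1Basis p)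

/-- The normalization of the templates: the value 1, rather than merely a nonzero one, makes the
normal trace of an edge's base function equal to its scalar factor. -/
lemma inner_template {s : ScalarIdx p} {e : Edge} (h : OnEdge s e) (k : Fin 2) :
    inner ℝ (normal e) (template s k) = 0 ∨ inner ℝ (normal e) (template s k) = 1 := by
  rcases s with i | ⟨f, j⟩ | j
  · fin_cases e <;> fin_cases i <;> fin_cases k <;>
      simp_all [OnEdge, src, tgt, template, vertexTemplate, inner_normal]
  · obtain rfl : f = e := h
    fin_cases f <;> fin_cases k <;>
      simp [template, edgeTemplate, inner_normal]
    norm_num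
  · exact h.elim

/-- At a vertex, each template vector is tangent to one of the two adjacent edges, so it projects
nontrivially only on the other one. -/
lemma existsUnique_isEdgeFunction {b : VecIdx p} (h : ¬ IsCellFunction b) :
    ∃! e, IsEdgeFunction b e := by
  obtain ⟨i | ⟨f, j⟩ | j, k⟩ := b
  · fin_cases i <;> fin_cases k <;>
      simp [IsEdgeFunction, OnEdge, src, tgt, template, vertexTemplate, inner_normal,
        ExistsUnique, Fin.forall_fin_succ]
  · exact ⟨f, ⟨rfl, h⟩, fun e he => he.1.symm⟩
  · exact absurd trivial h

lemma fn_eq_zero {s : ScalarIdx p} {e : Edge} (h : ¬ OnEdge s e) {ξ : E2} (hξ : ξ ∈ refEdge e) :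
    U.fn s ξ = 0 := U.polytopal s e h ξ hξ

lemma not_isEdgeFunction_of_isCellFunction {b : VecIdx p} (h : IsCellFunction b) (e : Edge) :
    ¬ IsEdgeFunction b e := by
  obtain ⟨i | ⟨f, j⟩ | j, k⟩ := b
  · exact h.elim
  · rintro ⟨rfl, h'⟩
    exact h' h
  · exact fun h' => h'.1

lemma inner_normal_bdm_of_isEdgeFunction {b : VecIdx p} {e : Edge} (h : IsEdgeFunction b e)
    (ξ : E2) : inner ℝ (normal e) (U.bdm b ξ) = U.fn b.1 ξ := by
  rw [H1Basis.bdm, inner_smul_right, (inner_template h.1 b.2).resolve_left h.2, mul_one]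

lemma inner_normal_bdm_of_not_isEdgeFunction {b : VecIdx p} {e : Edge}
    (h : ¬ IsEdgeFunction b e) {ξ : E2} (hξ : ξ ∈ refEdge e) :
    inner ℝ (normal e) (U.bdm b ξ) = 0 := by
  rw [H1Basis.bdm, inner_smul_right]
  by_cases hs : OnEdge b.1 e
  · rw [not_not.1 fun h' => h ⟨hs, h'⟩, mul_zero]
  · rw [fn_eq_zero U hs hξ, zero_mul]

lemma not_isCellFunction_of_isEdgeFunction {b : VecIdx p} {e : Edge} (h : IsEdgeFunction b e) :
    ¬ IsCellFunction b := fun h' => not_isEdgeFunction_of_isCellFunction h' e h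

/-- The base functions of an edge, listed as the function of the first vertex, that of the second
vertex, and the edge functions. -/
def edgeVec (p : ℕ) (e : Edge) : Fin 2 ⊕ Fin (p - 1) → VecIdx p
  -- The second component selects the one template vector of the polytope that is not tangent to
  -- `e`.
  | .inl 0 => (.inl (src e), ![0, 1, 1] e)
  | .inl 1 => (.inl (tgt e), ![0, 0, 1] e)
  | .inr k => (.inr (.inl (e, k)), 0)

lemma isEdgeFunction_edgeVec (e : Edge) (j : Fin 2 ⊕ Fin (p - 1)) :
    IsEdgeFunction (edgeVec p e j) e := by
  rcases j with j | k
  · fin_cases e <;> fin_cases j <;>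
      simp [edgeVec, IsEdgeFunction, OnEdge, src, tgt, template, vertexTemplate, inner_normal]
  · fin_cases e <;>
      simp [edgeVec, IsEdgeFunction, OnEdge, template, edgeTemplate, inner_normal]

lemma edgeVec_injective (e : Edge) : Function.Injective (edgeVec p e) := by
  have h : src e ≠ tgt e := by fin_cases e <;> decide
  rintro (j | k) (j' | k') hjk
  · fin_cases j <;> fin_cases j' <;> simp_all [edgeVec, eq_comm]
  · fin_cases j <;> simp_all [edgeVec]
  · fin_cases j' <;> simp_all [edgeVec]
  · simp_all [edgeVec]

lemma exists_edgeVec_eq {b : VecIdx p} {e : Edge} (h : IsEdgeFunction b e) :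
    ∃ j, edgeVec p e j = b := by
  obtain ⟨i | ⟨f, j⟩ | j, k⟩ := b
  · obtain ⟨h1, h2⟩ := h
    fin_cases e <;> fin_cases i <;> fin_cases k <;>
      simp_all [OnEdge, src, tgt, template, vertexTemplate, inner_normal, edgeVec,
        Fin.exists_fin_succ]
  · obtain ⟨h1, h2⟩ := h
    obtain rfl : f = e := h1
    refine ⟨.inr j, ?_⟩
    fin_cases f <;> fin_cases k <;>
      simp_all [template, edgeTemplate, inner_normal, edgeVec]
  · exact h.1.elim

lemma sameOnEdge_edgeVec (e e' : Edge) (j : Fin 2 ⊕ Fin (p - 1)) :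
    SameOnEdge e e' (edgeVec p e j).1 (edgeVec p e' j).1 := by
  rcases j with j | k
  · fin_cases j
    · exact Or.inl ⟨rfl, rfl⟩
    · exact Or.inr ⟨rfl, rfl⟩
  · exact ⟨rfl, rfl, rfl⟩

/-- The summation index does not depend on the edge, so traces on differently labelled local edges
of two elements can be compared term by term. -/
lemma inner_normal_field (c : VecIdx p → ℝ) (e : Edge) {ξ : E2} (hξ : ξ ∈ refEdge e) :
    inner ℝ (normal e) (U.field c ξ) =
      ∑ j, c (edgeVec p e j) * U.fn (edgeVec p e j).1 ξ := by
  simp only [H1Basis.field, inner_sum, inner_smul_right]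
  symm
  refine Finset.sum_of_injOn (edgeVec p e) (edgeVec_injective e).injOn (by simp) ?_ ?_
  · intro b _ hb
    rw [inner_normal_bdm_of_not_isEdgeFunction U _ hξ, mul_zero]
    intro h
    obtain ⟨j, rfl⟩ := exists_edgeVec_eq h
    simp at hb
  · intro j _
    rw [inner_normal_bdm_of_isEdgeFunction U (isEdgeFunction_edgeVec e j)]

end normalProjection

/-! ### The Piola transform -/

lemma inner_rot_piola {x : E2 → E2} (φ : E2 → E2) {ξ : E2} (h : (fderiv ℝ x ξ).det ≠ 0) (τ : E2) :
    inner ℝ (rot (fderiv ℝ x ξ τ)) (piola x φ ξ) = inner ℝ (rot τ) (φ ξ) :=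
  inner_rot_map_inv_det h _ _

variable {A : Set E2}

/-- The normal projections of an assembled function agree on common edges. -/
lemma Mesh.IsAssembled.inner_normal_eq {M : Mesh A} {p : ℕ} (U : H1Basis p)
    {c : Fin M.size → VecIdx p → ℝ} (hc : M.IsAssembled c) {K L : Fin M.size} {e e' : Edge}
    (h : M.SameEdge K L e e') {t : ℝ} (ht : t ∈ Set.Icc (0 : ℝ) 1) :
    inner ℝ (normal e) (U.field (c K) (edgePoint e t)) =
      inner ℝ (normal e') (U.field (c L) (edgePoint e' t)) := by
  rw [inner_normal_field U _ e ⟨t, ht, rfl⟩, inner_normal_field U _ e' ⟨t, ht, rfl⟩]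
  refine Finset.sum_congr rfl fun j _ => ?_
  congr 1
  · exact hc K L e e' h _ _ (sameOnEdge_edgeVec e e' j) (isEdgeFunction_edgeVec e j)
      (isEdgeFunction_edgeVec e' j)
  · exact U.conforming e e' _ _ (sameOnEdge_edgeVec e e' j) t ht

lemma hasDerivAt_edgePoint (e : Edge) (t : ℝ) : HasDerivAt (edgePoint e) (tangent e) t := by
  have h := ((hasDerivAt_id t).smul_const (tangent e)).const_add (refVertex (src e))
  rwa [one_smul] at h

lemma Mesh.hasFDerivAt (M : Mesh A) (K : Fin M.size) (ξ : E2) :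
    HasFDerivAt (M.map K) (fderiv ℝ (M.map K) ξ) ξ :=
  ((M.contDiff K).differentiable one_ne_zero ξ).hasFDerivAt

/-- The tangent vectors of a common edge agree. -/
lemma Mesh.SameEdge.fderiv_tangent_eq {M : Mesh A} {K L : Fin M.size} {e e' : Edge}
    (h : M.SameEdge K L e e') {t : ℝ} (ht : t ∈ Set.Icc (0 : ℝ) 1) :
    fderiv ℝ (M.map K) (edgePoint e t) (tangent e) =
      fderiv ℝ (M.map L) (edgePoint e' t) (tangent e') := by
  -- The two parametrizations agree only on [0, 1]; derivatives within this interval are unique also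
  -- at its endpoints.
  have h1 := ((M.hasFDerivAt K _).comp_hasDerivAt t (hasDerivAt_edgePoint e t)).hasDerivWithinAt
    (s := Set.Icc 0 1)
  have h2 := ((M.hasFDerivAt L _).comp_hasDerivAt t (hasDerivAt_edgePoint e' t)).hasDerivWithinAt
    (s := Set.Icc 0 1)
  refine (uniqueDiffOn_Icc_zero_one t ht).eq_deriv _ h1 (h2.congr ?_ ?_)
  · exact fun s hs => M.edge_eq K L e e' h.1 h.2 s hs
  · exact M.edge_eq K L e e' h.1 h.2 t ht

lemma Mesh.fderiv_tangent_ne_zero (M : Mesh A) (K : Fin M.size) (e : Edge) {t : ℝ}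
    (ht : t ∈ Set.Icc (0 : ℝ) 1) : fderiv ℝ (M.map K) (edgePoint e t) (tangent e) ≠ 0 := by
  set L := fderiv ℝ (M.map K) (edgePoint e t) with hL
  have hdet : L.det ≠ 0 := M.det_ne_zero K _ (edgePoint_mem e ht)
  intro h
  -- If `L τ` were zero, the area form of `L τ` and `L (R τ)` would vanish, although it equals det L
  -- · |R τ|².
  have h2 := inner_rot_map L (tangent e) (rot (tangent e))
  rw [h, inner_eq] at h2
  have h3 : inner ℝ (rot (tangent e)) (rot (tangent e)) = 0 := by
    simpa [hdet] using h2
  rw [inner_self_eq_zero] at h3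
  apply tangent_ne_zero e
  have h4 := congrArg (fun v : E2 => v 0) h3
  have h5 := congrArg (fun v : E2 => v 1) h3
  exact e2_ext (by simpa using h5) (by simpa using h4)

/-- The normal components of an assembled function do not jump across common edges. -/
lemma Mesh.IsAssembled.inner_piola_eq {M : Mesh A} {p : ℕ} (U : H1Basis p)
    {c : Fin M.size → VecIdx p → ℝ} (hc : M.IsAssembled c) {K L : Fin M.size} {e e' : Edge}
    (h : M.SameEdge K L e e') {t : ℝ} (ht : t ∈ Set.Icc (0 : ℝ) 1) {n : E2}
    (hn : inner ℝ n (fderiv ℝ (M.map K) (edgePoint e t) (tangent e)) = 0) :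
    inner ℝ n (piola (M.map K) (U.field (c K)) (edgePoint e t)) =
      inner ℝ n (piola (M.map L) (U.field (c L)) (edgePoint e' t)) := by
  obtain ⟨a, rfl⟩ := eq_smul_rot_of_inner_eq_zero (M.fderiv_tangent_ne_zero K e ht) hn
  rw [real_inner_smul_left, real_inner_smul_left,
    inner_rot_piola _ (M.det_ne_zero K _ (edgePoint_mem e ht)), h.fderiv_tangent_eq ht,
    inner_rot_piola _ (M.det_ne_zero L _ (edgePoint_mem e' ht))]
  exact congrArg (a * ·) (hc.inner_normal_eq U h ht)

/-! ### Topology of the reference triangle -/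

lemma continuous_edgePoint (e : Edge) : Continuous (edgePoint e) := by
  unfold edgePoint; fun_prop

lemma isClosed_refTriangle : IsClosed refTriangle := by
  have : refTriangle = ⋂ e, bary e ⁻¹' Set.Ici 0 := by
    ext ξ; simp [mem_refTriangle_iff]
  rw [this]
  exact isClosed_iInter fun e => isClosed_Ici.preimage (continuous_bary e)

lemma convex_refTriangle : Convex ℝ refTriangle := by
  rintro ξ ⟨h1, h2, h3⟩ ζ ⟨h4, h5, h6⟩ a b ha hb hab
  refine ⟨?_, ?_, ?_⟩ <;> simp only [PiLp.add_apply, PiLp.smul_apply, smul_eq_mul]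
  · positivity
  · positivity
  · nlinarith

lemma isCompact_refTriangle : IsCompact refTriangle := by
  refine Metric.isCompact_of_isClosed_isBounded isClosed_refTriangle ?_
  refine (Metric.isBounded_closedBall (x := (0 : E2)) (r := 2)).subset ?_
  rintro ξ ⟨h1, h2, h3⟩
  rw [mem_closedBall_zero_iff, EuclideanSpace.norm_eq, Real.sqrt_le_left (by norm_num)]
  simp only [Fin.sum_univ_two, Real.norm_eq_abs, sq_abs]
  nlinarith

lemma exists_deriv_bary_neg (e : Edge) : ∃ w : E2, normalSign e * inner ℝ (normal e) w = 1 := by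
  fin_cases e
  · exact ⟨!₂[-1, 0], by simp [inner_normal]⟩
  · exact ⟨!₂[0, -1], by simp [inner_normal]⟩
  · exact ⟨!₂[1, 0], by simp [inner_normal]⟩

lemma mem_interior_refTriangle_iff {ξ : E2} : ξ ∈ interior refTriangle ↔ ∀ e, 0 < bary e ξ := by
  constructor
  -- A small step of length parameter `s > 0` along `w` stays in the triangle and lowers the
  -- coordinate by exactly `s`, so the coordinate was at least `s`.
  · intro h e
    obtain ⟨w, hw⟩ := exists_deriv_bary_neg e
    have hc : Tendsto (fun s : ℝ => ξ + s • w) (𝓝[>] 0) (𝓝 ξ) := by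
      have : Continuous fun s : ℝ => ξ + s • w := by fun_prop
      simpa using (this.tendsto 0).mono_left nhdsWithin_le_nhds
    obtain ⟨s, hs, hs0⟩ :=
      ((hc.eventually (mem_interior_iff_mem_nhds.1 h)).and self_mem_nhdsWithin).exists
    have h1 := mem_refTriangle_iff.1 hs e
    have h2 := bary_sub e (ξ + s • w) ξ
    rw [add_sub_cancel_left, inner_smul_right] at h2
    have h3 : normalSign e * (s * inner ℝ (normal e) w) = s := by linear_combination s * hw
    rw [h3] at h2
    have : 0 < s := hs0
    linarith
  · intro h
    refine mem_interior.2 ⟨⋂ e, bary e ⁻¹' Set.Ioi 0, ?_, ?_, by simpa using h⟩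
    · intro ζ hζ
      rw [Set.mem_iInter] at hζ
      exact mem_refTriangle_iff.2 fun e => le_of_lt (hζ e)
    · exact isOpen_iInter_of_finite fun e => isOpen_Ioi.preimage (continuous_bary e)

lemma edgePoint_notMem_interior (e : Edge) (t : ℝ) : edgePoint e t ∉ interior refTriangle :=
  fun h => (mem_interior_refTriangle_iff.1 h e).ne' (bary_edgePoint e t)

lemma refVertex_notMem_interior (i : Fin 3) : refVertex i ∉ interior refTriangle := by
  obtain ⟨e, _, _, h, _⟩ := exists_bary_refVertex_eq_zero i
  exact fun h' => (mem_interior_refTriangle_iff.1 h' e).ne' h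

lemma edgePoint_injective (e : Edge) : Function.Injective (edgePoint e) := by
  intro s t h
  have h0 := congrArg (fun v : E2 => v 0) h
  have h1 := congrArg (fun v : E2 => v 1) h
  fin_cases e <;> simp_all [edgePoint_zero, edgePoint_one, edgePoint_two]

/-- A relatively interior point of an edge lies on no other edge. -/
lemma eq_of_edgePoint_eq {e e' : Edge} {t t' : ℝ} (ht : t ∈ Set.Ioo (0 : ℝ) 1)
    (h : edgePoint e t = edgePoint e' t') : e' = e ∧ t' = t := by
  obtain rfl : e' = e := by
    by_contra hne
    have := bary_edgePoint_pos hne ht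
    rw [h, bary_edgePoint] at this
    exact lt_irrefl _ this
  exact ⟨rfl, (edgePoint_injective _ h).symm⟩

/-- A vertex annihilates two barycentric coordinates, a relatively interior edge point only one. -/
lemma edgePoint_ne_refVertex {e : Edge} {t : ℝ} (ht : t ∈ Set.Ioo (0 : ℝ) 1) (i : Fin 3) :
    edgePoint e t ≠ refVertex i := by
  intro h
  obtain ⟨f, f', hne, h1, h2⟩ := exists_bary_refVertex_eq_zero i
  rw [← h] at h1 h2
  by_cases hf : f = e
  · exact (bary_edgePoint_pos (fun h' => hne (hf.trans h'.symm)) ht).ne' h2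
  · exact (bary_edgePoint_pos hf ht).ne' h1

lemma eventually_pos_of_hasDerivAt {f : ℝ → ℝ} {f' a : ℝ} (h : HasDerivAt f f' a) (h0 : f a = 0)
    (hf' : 0 < f') : ∀ᶠ s in 𝓝[>] a, 0 < f s := by
  have h1 := (hasDerivAt_iff_tendsto_slope.1 h).mono_left
    (nhdsWithin_mono a (fun s (hs : a < s) => hs.ne' : Set.Ioi a ⊆ {a}ᶜ))
  filter_upwards [h1.eventually (lt_mem_nhds hf'), self_mem_nhdsWithin] with s hs hs'
  have : 0 < s - a := sub_pos.2 hs'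
  rw [slope_def_field, h0, sub_zero] at hs
  exact (div_pos_iff_of_pos_right this).1 hs

/-! ### The sides of an edge -/

variable (M : Mesh A)

/-- The sign of the Jacobian determinant of an element. -/
noncomputable def Mesh.orient (K : Fin M.size) : ℝ :=
  SignType.sign (fderiv ℝ (M.map K) (refVertex 0)).det

lemma Mesh.continuous_fderiv (K : Fin M.size) : Continuous (fderiv ℝ (M.map K)) :=
  (M.contDiff K).continuous_fderiv one_ne_zero

lemma Mesh.continuous_det (K : Fin M.size) : Continuous fun ξ => (fderiv ℝ (M.map K) ξ).det :=
  ContinuousLinearMap.continuous_det.comp (M.continuous_fderiv K)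

lemma refVertex_mem (i : Fin 3) : refVertex i ∈ refTriangle := by
  fin_cases i <;> simp [refVertex, refTriangle]

/-- The determinant is continuous without zeros on a connected set, so its sign is constant. -/
lemma Mesh.sign_det (K : Fin M.size) {ξ : E2} (hξ : ξ ∈ refTriangle) :
    (SignType.sign (fderiv ℝ (M.map K) ξ).det : ℝ) = M.orient K := by
  have hc : ContinuousOn (fun ξ => SignType.sign (fderiv ℝ (M.map K) ξ).det) refTriangle :=
    fun ζ hζ => (ContinuousAt.comp (f := fun ξ => (fderiv ℝ (M.map K) ξ).det)
      (continuousAt_sign_of_ne_zero (M.det_ne_zero K ζ hζ))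
      (M.continuous_det K).continuousAt).continuousWithinAt
  rw [Mesh.orient, ← convex_refTriangle.isPreconnected.constant hc hξ (refVertex_mem 0)]

lemma Mesh.abs_det (K : Fin M.size) {ξ : E2} (hξ : ξ ∈ refTriangle) :
    |(fderiv ℝ (M.map K) ξ).det| = M.orient K * (fderiv ℝ (M.map K) ξ).det := by
  rw [← M.sign_det K hξ, sign_mul_self]

/-- The side on which the element `K` lies of its edge `e`, directed by its parametrization. -/
noncomputable def Mesh.side (K : Fin M.size) (e : Edge) : ℝ := M.orient K * normalSign e

lemma Mesh.orient_eq (K : Fin M.size) : M.orient K = 1 ∨ M.orient K = -1 := by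
  rcases lt_or_gt_of_ne (M.det_ne_zero K _ (refVertex_mem 0)) with h | h
  · right; simp [Mesh.orient, h]
  · left; simp [Mesh.orient, h]

lemma Mesh.side_eq (K : Fin M.size) (e : Edge) : M.side K e = 1 ∨ M.side K e = -1 := by
  have h : normalSign e = 1 ∨ normalSign e = -1 := by fin_cases e <;> simp
  rcases M.orient_eq K with h1 | h1 <;> rcases h with h2 | h2 <;> simp [Mesh.side, h1, h2]

/-- A segment that starts at a point of an element, pulled back by the element map. -/
lemma Mesh.exists_pullback_segment (K : Fin M.size) {ξ : E2} (hξ : ξ ∈ refTriangle) (v : E2) :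
    ∃ (h : ℝ → E2) (w : E2), fderiv ℝ (M.map K) ξ w = v ∧ h 0 = ξ ∧ HasDerivAt h w 0 ∧
      (∀ᶠ s in 𝓝 (0 : ℝ), M.map K (h s) = M.map K ξ + s • v) ∧
      (∀ᶠ s in 𝓝 (0 : ℝ), ∀ ζ ∈ refTriangle, M.map K ζ = M.map K ξ + s • v → ζ = h s) := by
  set J := (fderiv ℝ (M.map K) ξ).toContinuousLinearEquivOfDetNeZero (M.det_ne_zero K ξ hξ) with hJ
  have hs : HasStrictFDerivAt (M.map K) (J : E2 →L[ℝ] E2) ξ := by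
    rw [hJ, ContinuousLinearMap.coe_toContinuousLinearEquivOfDetNeZero]
    exact (M.contDiff K).contDiffAt.hasStrictFDerivAt one_ne_zero
  have hseg : HasDerivAt (fun s : ℝ => M.map K ξ + s • v) v 0 := by
    have := ((hasDerivAt_id (0 : ℝ)).smul_const v).const_add (M.map K ξ)
    rwa [one_smul] at this
  have hlim : Tendsto (fun s : ℝ => M.map K ξ + s • v) (𝓝 0) (𝓝 (M.map K ξ)) := by
    simpa using hseg.continuousAt.tendsto
  refine ⟨fun s => hs.localInverse _ _ _ (M.map K ξ + s • v), J.symm v, ?_, by simp, ?_, ?_, ?_⟩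
  · exact J.apply_symm_apply v
  · refine HasFDerivAt.comp_hasDerivAt (0 : ℝ) (l := hs.localInverse _ _ _)
      (l' := (J.symm : E2 →L[ℝ] E2)) ?_ hseg
    simpa using hs.to_localInverse.hasFDerivAt
  · exact hlim.eventually hs.eventually_right_inverse
  -- The local inverse controls only preimages in `V`. The image of the rest of the triangle is
  -- compact and, by injectivity, misses the base point, so for small `s` every preimage in the
  -- triangle lies in `V`.
  · obtain ⟨V, hV, hVo, hξV⟩ := eventually_nhds_iff.1 hs.eventually_left_inverse
    have hC : IsClosed (M.map K '' (refTriangle \ V)) :=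
      ((isCompact_refTriangle.diff hVo).image (M.contDiff K).continuous).isClosed
    have hx : M.map K ξ ∈ (M.map K '' (refTriangle \ V))ᶜ := by
      rintro ⟨ζ, ⟨hζ, hζV⟩, h⟩
      rw [M.injOn K hζ hξ h] at hζV
      exact hζV hξV
    filter_upwards [hlim.eventually (hC.isOpen_compl.mem_nhds hx)] with s hs' ζ hζ h
    have hζV : ζ ∈ V := by
      by_contra hn
      exact hs' ⟨ζ, ⟨hζ, hn⟩, h⟩
    rw [← h, hV ζ hζV]

lemma hasDerivAt_bary {h : ℝ → E2} {w : E2} {s : ℝ} (hh : HasDerivAt h w s) (e : Edge) :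
    HasDerivAt (fun s => bary e (h s)) (-(normalSign e * inner ℝ (normal e) w)) s := by
  have h1 : (fun s => bary e (h s)) =
      fun s => bary e 0 + -(normalSign e * inner ℝ (normal e) (h s)) := by
    ext s
    have := bary_sub e (h s) 0
    rw [sub_zero] at this
    linarith
  rw [h1]
  have h2 := (((hasDerivAt_const s (normal e)).inner ℝ hh).const_mul (normalSign e)).neg.const_add
    (bary e 0)
  simpa using h2

section side

variable (K : Fin M.size) (e : Edge) {t : ℝ} (ht : t ∈ Set.Ioo (0 : ℝ) 1) {v : E2}
include ht

/-- Along the pulled-back segment the coordinate of `e` starts at zero with positive derivative,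
while the other two start positive and remain so by continuity. -/
lemma Mesh.eventually_mem_of_side
    (hv : M.side K e *
      inner ℝ (rot (fderiv ℝ (M.map K) (edgePoint e t) (tangent e))) v < 0) :
    ∀ᶠ s in 𝓝[>] (0 : ℝ),
      M.map K (edgePoint e t) + s • v ∈ M.map K '' interior refTriangle := by
  have hξ := edgePoint_mem e (Set.Ioo_subset_Icc_self ht)
  obtain ⟨h, w, hw, h0, hd, h1, -⟩ := M.exists_pullback_segment K hξ v
  rw [← hw, inner_rot_map] at hv
  have hpos : 0 < -(normalSign e * inner ℝ (normal e) w) := by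
    have h2 : 0 < |(fderiv ℝ (M.map K) (edgePoint e t)).det| := abs_pos.2 (M.det_ne_zero K _ hξ)
    rw [M.abs_det K hξ] at h2
    rw [Mesh.side] at hv
    refine pos_of_mul_pos_right (a := M.orient K * _) ?_ h2.le
    rw [normal]
    linarith
  have h3 : ∀ᶠ s in 𝓝[>] (0 : ℝ), ∀ e', 0 < bary e' (h s) := by
    rw [eventually_all]
    intro e'
    by_cases hee : e' = e
    · subst hee
      exact eventually_pos_of_hasDerivAt (hasDerivAt_bary hd e') (by rw [h0, bary_edgePoint]) hpos
    · have hc : ContinuousAt (fun s => bary e' (h s)) 0 :=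
        (continuous_bary e').continuousAt.comp hd.continuousAt
      refine (hc.eventually (lt_mem_nhds ?_)).filter_mono nhdsWithin_le_nhds
      simpa only [h0] using bary_edgePoint_pos hee ht
  filter_upwards [h3, h1.filter_mono nhdsWithin_le_nhds] with s hs hs'
  exact ⟨h s, mem_interior_refTriangle_iff.2 hs, hs'⟩

/-- Here the coordinate of `e` becomes negative along the pulled-back curve, which is the only
possible preimage of the segment in the triangle. -/
lemma Mesh.eventually_notMem_of_side
    (hv : 0 < M.side K e *
      inner ℝ (rot (fderiv ℝ (M.map K) (edgePoint e t) (tangent e))) v) :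
    ∀ᶠ s in 𝓝[>] (0 : ℝ), M.map K (edgePoint e t) + s • v ∉ M.map K '' refTriangle := by
  have hξ := edgePoint_mem e (Set.Ioo_subset_Icc_self ht)
  obtain ⟨h, w, hw, h0, hd, -, h1⟩ := M.exists_pullback_segment K hξ v
  rw [← hw, inner_rot_map] at hv
  have hpos : 0 < normalSign e * inner ℝ (normal e) w := by
    have h2 : 0 < |(fderiv ℝ (M.map K) (edgePoint e t)).det| := abs_pos.2 (M.det_ne_zero K _ hξ)
    rw [M.abs_det K hξ] at h2
    rw [Mesh.side] at hv
    refine pos_of_mul_pos_right (a := M.orient K * _) ?_ h2.le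
    rw [normal]
    linarith
  have h3 := eventually_pos_of_hasDerivAt (hasDerivAt_bary hd e).neg
    (by simp [h0, bary_edgePoint]) (by simpa using hpos)
  filter_upwards [h3, h1.filter_mono nhdsWithin_le_nhds] with s hs hs'
  rintro ⟨ζ, hζ, h4⟩
  have h5 := mem_refTriangle_iff.1 hζ e
  rw [hs' ζ hζ h4] at h5
  simp only [Pi.neg_apply] at hs
  linarith

end side

lemma Mesh.eq_of_mem_interior {K L : Fin M.size} {ξ ζ : E2} (hξ : ξ ∈ interior refTriangle)
    (hζ : ζ ∈ refTriangle) (h : M.map K ξ = M.map L ζ) : K = L := by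
  by_contra hKL
  rcases M.inter K L hKL ξ (interior_subset hξ) ζ hζ h with
    ⟨i, j, -, rfl, -⟩ | ⟨e, e', -, -, t, -, rfl, -⟩
  · exact refVertex_notMem_interior i hξ
  · exact edgePoint_notMem_interior e t hξ

variable {M} in
lemma Mesh.SameEdge.eq {K : Fin M.size} {e e' : Edge} (h : M.SameEdge K K e e') : e = e' := by
  have h1 := (M.vert_strictMono K).injective h.1
  have h2 := (M.vert_strictMono K).injective h.2
  fin_cases e <;> fin_cases e' <;> simp_all [src, tgt]

/-- The elements that contain a relatively interior point of an edge share this edge. -/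
lemma Mesh.exists_sameEdge (K L : Fin M.size) (e : Edge) {t : ℝ} (ht : t ∈ Set.Ioo (0 : ℝ) 1)
    (h : M.map K (edgePoint e t) ∈ M.map L '' refTriangle) : ∃ e', M.SameEdge K L e e' := by
  by_cases hKL : K = L
  · subst hKL
    exact ⟨e, rfl, rfl⟩
  obtain ⟨ζ, hζ, h⟩ := h
  have hξ := edgePoint_mem e (Set.Ioo_subset_Icc_self ht)
  rcases M.inter K L hKL _ hξ ζ hζ h.symm with ⟨i, j, -, h1, -⟩ | ⟨f, f', h1, h2, t', -, h3, -⟩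
  · exact absurd h1 (edgePoint_ne_refVertex ht i)
  · obtain ⟨rfl, -⟩ := eq_of_edgePoint_eq ht h3
    exact ⟨f', h1, h2⟩

/-- On each side of an edge in the domain lies exactly one element. -/
lemma Mesh.existsUnique_side (hA : IsOpen A) (K : Fin M.size) (e : Edge) {t : ℝ}
    (ht : t ∈ Set.Ioo (0 : ℝ) 1) (hx : M.map K (edgePoint e t) ∈ A) {ε : ℝ}
    (hε : ε = 1 ∨ ε = -1) :
    ∃! a : Fin M.size × Edge, M.SameEdge K a.1 e a.2 ∧ M.side a.1 a.2 = ε := by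
  have ht' := Set.Ioo_subset_Icc_self ht
  set x := M.map K (edgePoint e t) with hxdef
  set T := fderiv ℝ (M.map K) (edgePoint e t) (tangent e) with hT
  have hT0 : 0 < inner ℝ (rot T) (rot T) := by
    have h0 := M.fderiv_tangent_ne_zero K e ht'
    rw [real_inner_self_pos]
    intro h
    apply h0
    have h1 := congrArg (fun v : E2 => v 0) h
    have h2 := congrArg (fun v : E2 => v 1) h
    exact e2_ext (by simpa using h2) (by simpa using h1)
  -- The direction pointing off the edge into the elements of side `ε`: for these the signed area
  -- form is -ε² |R T|² < 0.
  set v : E2 := (-ε) • rot T with hv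
  have hvT : inner ℝ (rot T) v = -ε * inner ℝ (rot T) (rot T) := inner_smul_right _ _ _
  have hεε : ε * ε = 1 := by rcases hε with h | h <;> simp [h]
  have hin : ∀ a : Fin M.size × Edge, M.SameEdge K a.1 e a.2 → M.side a.1 a.2 = ε →
      ∀ᶠ s in 𝓝[>] (0 : ℝ), x + s • v ∈ M.map a.1 '' interior refTriangle := by
    intro a ha hs
    have hp := M.edge_eq K a.1 e a.2 ha.1 ha.2 t ht'
    rw [hxdef, hp]
    refine M.eventually_mem_of_side a.1 a.2 ht ?_
    rw [← ha.fderiv_tangent_eq ht', ← hT, hvT, hs]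
    nlinarith
  have hout : ∀ a : Fin M.size × Edge, M.SameEdge K a.1 e a.2 → M.side a.1 a.2 = -ε →
      ∀ᶠ s in 𝓝[>] (0 : ℝ), x + s • v ∉ M.map a.1 '' refTriangle := by
    intro a ha hs
    have hp := M.edge_eq K a.1 e a.2 ha.1 ha.2 t ht'
    rw [hxdef, hp]
    refine M.eventually_notMem_of_side a.1 a.2 ht ?_
    rw [← ha.fderiv_tangent_eq ht', ← hT, hvT, hs]
    nlinarith
  refine existsUnique_of_exists_of_unique ?_ ?_
  -- Without an element on side `ε`, the elements sharing the edge leave the segment free, and the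
  -- others, being closed and not containing `x`, miss it near `x`. But the segment starts inside
  -- `A`, which the finitely many elements cover.
  · by_contra hno
    push Not at hno
    have hlim : Tendsto (fun s : ℝ => x + s • v) (𝓝[>] 0) (𝓝 x) := by
      have : Continuous fun s : ℝ => x + s • v := by fun_prop
      simpa using (this.tendsto 0).mono_left nhdsWithin_le_nhds
    have hall : ∀ᶠ s in 𝓝[>] (0 : ℝ), ∀ L, x + s • v ∉ M.map L '' refTriangle := by
      rw [eventually_all]
      intro L
      by_cases hL : x ∈ M.map L '' refTriangle
      · obtain ⟨e', he'⟩ := M.exists_sameEdge K L e ht hL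
        refine hout (L, e') he' ?_
        have h1 := hno (L, e') he'
        have h2 := M.side_eq L e'
        rcases hε with rfl | rfl
        · exact h2.resolve_left h1
        · rw [neg_neg]
          exact h2.resolve_right h1
      · have hC : IsClosed (M.map L '' refTriangle) :=
          (isCompact_refTriangle.image (M.contDiff L).continuous).isClosed
        exact hlim.eventually (hC.isOpen_compl.mem_nhds hL)
    obtain ⟨s, hs, hsA⟩ := (hall.and (hlim.eventually (hA.mem_nhds hx))).exists
    have := M.closure_eq ▸ subset_closure hsA
    rw [Set.mem_iUnion] at this
    exact this.elim hs
  -- Two elements on the same side both contain the start of the segment in their interiors, so they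
  -- coincide; the vertex numbers then determine the local edge.
  · rintro ⟨L, f⟩ ⟨L', f'⟩ ⟨h1, h2⟩ ⟨h3, h4⟩
    obtain ⟨s, ⟨ξ, hξ, h5⟩, ⟨ζ, hζ, h6⟩⟩ := ((hin _ h1 h2).and (hin _ h3 h4)).exists
    obtain rfl : L = L' := M.eq_of_mem_interior hξ (interior_subset hζ) (h5.trans h6.symm)
    have h7 : M.SameEdge L L f f' := ⟨h1.1.symm.trans h3.1, h1.2.symm.trans h3.2⟩
    rw [h7.eq]

open Classical in
/-- At a relatively interior edge point in the domain the sides of the adjacent elements cancel. -/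
lemma Mesh.sum_side_eq_zero (hA : IsOpen A) (K : Fin M.size) (e : Edge) {t : ℝ}
    (ht : t ∈ Set.Ioo (0 : ℝ) 1) (hx : M.map K (edgePoint e t) ∈ A) :
    ∑ a : Fin M.size × Edge with M.SameEdge K a.1 e a.2, M.side a.1 a.2 = 0 := by
  -- As sides are ±1, the sum counts the pairs of side 1 minus those of side -1, and there is one of
  -- each.
  have h : ∀ a : Fin M.size × Edge, M.side a.1 a.2 =
      (if M.side a.1 a.2 = 1 then 1 else 0) - (if M.side a.1 a.2 = -1 then 1 else 0) := by
    intro a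
    rcases M.side_eq a.1 a.2 with h | h <;> norm_num [h]
  have hcard : ∀ ε : ℝ, ε = 1 ∨ ε = -1 →
      ∑ a : Fin M.size × Edge with M.SameEdge K a.1 e a.2,
        (if M.side a.1 a.2 = ε then (1 : ℝ) else 0) = 1 := by
    intro ε hε
    obtain ⟨a, ha, hu⟩ := M.existsUnique_side hA K e ht hx hε
    rw [Finset.sum_eq_single_of_mem a (by simpa using ha.1), if_pos ha.2]
    intro b hb hne
    rw [if_neg]
    exact fun h' => hne (hu b ⟨by simpa using hb, h'⟩)
  rw [Finset.sum_congr rfl fun a _ => h a, Finset.sum_sub_distrib, hcard 1 (Or.inl rfl),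
    hcard (-1) (Or.inr rfl), sub_self]

/-! ### The divergence theorem on the reference triangle -/

/-- The reference triangle in the product of two lines. -/
def prodTriangle : Set (ℝ × ℝ) := {z | 0 ≤ z.1 ∧ 0 ≤ z.2 ∧ z.1 + z.2 ≤ 1}

lemma isClosed_prodTriangle : IsClosed prodTriangle :=
  (isClosed_le continuous_const continuous_fst).inter
    ((isClosed_le continuous_const continuous_snd).inter
      (isClosed_le (continuous_fst.add continuous_snd) continuous_const))

lemma isCompact_prodTriangle : IsCompact prodTriangle := by
  refine (isCompact_Icc (a := ((0, 0) : ℝ × ℝ)) (b := (1, 1))).of_isClosed_subset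
    isClosed_prodTriangle ?_
  rintro ⟨x, y⟩ ⟨h1, h2, h3⟩
  simp only at h1 h2 h3
  exact ⟨⟨h1, h2⟩, ⟨by simp only; linarith, by simp only; linarith⟩⟩

lemma setIntegral_prodTriangle {g : ℝ × ℝ → ℝ} (hg : Continuous g) :
    ∫ z in prodTriangle, g z = ∫ x in (0 : ℝ)..1, ∫ y in (0 : ℝ)..(1 - x), g (x, y) := by
  have hint : Integrable (prodTriangle.indicator g) (volume.prod volume) :=
    (integrable_indicator_iff isClosed_prodTriangle.measurableSet).2
      (hg.continuousOn.integrableOn_compact isCompact_prodTriangle)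
  have hx : ∀ x, ∫ y, prodTriangle.indicator g (x, y) =
      (Set.Icc (0 : ℝ) 1).indicator (fun x => ∫ y in (0 : ℝ)..(1 - x), g (x, y)) x := by
    intro x
    by_cases h : x ∈ Set.Icc (0 : ℝ) 1
    · rw [Set.indicator_of_mem h, intervalIntegral.integral_of_le (by linarith [h.2]),
        ← integral_Icc_eq_integral_Ioc, ← integral_indicator measurableSet_Icc]
      congr 1 with y
      by_cases hy : y ∈ Set.Icc 0 (1 - x)
      · rw [Set.indicator_of_mem hy, Set.indicator_of_mem]
        exact ⟨h.1, hy.1, by have := hy.2; simp only; linarith⟩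
      · rw [Set.indicator_of_notMem hy, Set.indicator_of_notMem]
        rintro ⟨h1, h2, h3⟩
        exact hy ⟨h2, by simp only at h3; linarith⟩
    · rw [Set.indicator_of_notMem h]
      refine integral_eq_zero_of_ae (ae_of_all _ fun y => Set.indicator_of_notMem ?_ _)
      rintro ⟨h1, h2, h3⟩
      simp only at h1 h2 h3
      exact h ⟨h1, by linarith⟩
  rw [← integral_indicator isClosed_prodTriangle.measurableSet, Measure.volume_eq_prod,
    integral_prod _ hint]
  simp only [hx]
  rw [integral_indicator measurableSet_Icc, intervalIntegral.integral_of_le zero_le_one,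
    integral_Icc_eq_integral_Ioc]

lemma setIntegral_prodTriangle_swap {g : ℝ × ℝ → ℝ} (hg : Continuous g) :
    ∫ z in prodTriangle, g z = ∫ y in (0 : ℝ)..1, ∫ x in (0 : ℝ)..(1 - y), g (x, y) := by
  have h := (Measure.measurePreserving_swap (μ := (volume : Measure ℝ))
    (ν := (volume : Measure ℝ))).setIntegral_preimage_emb
    MeasurableEquiv.prodComm.measurableEmbedding g prodTriangle
  have hpre : (Prod.swap : ℝ × ℝ → ℝ × ℝ) ⁻¹' prodTriangle = prodTriangle := by
    ext z
    simp only [prodTriangle, Set.mem_preimage, Set.mem_ofPred_eq, Prod.fst_swap, Prod.snd_swap,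
      add_comm]
    tauto
  rw [hpre] at h
  exact h.symm.trans (setIntegral_prodTriangle (hg.comp continuous_swap))

/-- The plane as a product of two lines. -/
noncomputable def prodEquiv : E2 ≃ᵐ ℝ × ℝ :=
  (MeasurableEquiv.toLp 2 (Fin 2 → ℝ)).symm.trans MeasurableEquiv.finTwoArrow

lemma setIntegral_refTriangle (f : E2 → ℝ) :
    ∫ ξ in refTriangle, f ξ = ∫ z in prodTriangle, f !₂[z.1, z.2] := by
  have hmp : MeasurePreserving prodEquiv :=
    (volume_preserving_finTwoArrow ℝ).comp
      (EuclideanSpace.volume_preserving_symm_measurableEquiv_toLp (Fin 2))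
  have h := hmp.setIntegral_preimage_emb prodEquiv.measurableEmbedding
    (fun z => f !₂[z.1, z.2]) prodTriangle
  have hid : ∀ ξ : E2, !₂[(prodEquiv ξ).1, (prodEquiv ξ).2] = ξ := fun ξ => e2_ext rfl rfl
  simp only [hid] at h
  exact h

/-- The divergence of a vector field. -/
noncomputable def div (F : E2 → E2) (ξ : E2) : ℝ :=
  fderiv ℝ F ξ !₂[1, 0] 0 + fderiv ℝ F ξ !₂[0, 1] 1

lemma hasDerivAt_comp_fst {F : E2 → E2} (hF : ContDiff ℝ 1 F) (x y : ℝ) :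
    HasDerivAt (fun x => F !₂[x, y] 0) (fderiv ℝ F !₂[x, y] !₂[1, 0] 0) x := by
  have h1 : HasDerivAt (fun x : ℝ => (!₂[x, y] : E2)) !₂[1, 0] x := by
    have := ((hasDerivAt_id x).smul_const (!₂[1, 0] : E2)).const_add (!₂[0, y] : E2)
    rw [one_smul] at this
    refine this.congr_of_eventuallyEq (Eventually.of_forall fun s => e2_ext ?_ ?_) <;> simp
  have h2 := ((hF.differentiable one_ne_zero _).hasFDerivAt).comp_hasDerivAt x h1
  exact (EuclideanSpace.proj (𝕜 := ℝ) (0 : Fin 2)).hasFDerivAt.comp_hasDerivAt x h2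

lemma hasDerivAt_comp_snd {F : E2 → E2} (hF : ContDiff ℝ 1 F) (x y : ℝ) :
    HasDerivAt (fun y => F !₂[x, y] 1) (fderiv ℝ F !₂[x, y] !₂[0, 1] 1) y := by
  have h1 : HasDerivAt (fun y : ℝ => (!₂[x, y] : E2)) !₂[0, 1] y := by
    have := ((hasDerivAt_id y).smul_const (!₂[0, 1] : E2)).const_add (!₂[x, 0] : E2)
    rw [one_smul] at this
    refine this.congr_of_eventuallyEq (Eventually.of_forall fun s => e2_ext ?_ ?_) <;> simp
  have h2 := ((hF.differentiable one_ne_zero _).hasFDerivAt).comp_hasDerivAt y h1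
  exact (EuclideanSpace.proj (𝕜 := ℝ) (1 : Fin 2)).hasFDerivAt.comp_hasDerivAt y h2

lemma continuous_toE2 : Continuous fun z : ℝ × ℝ => (!₂[z.1, z.2] : E2) := by
  refine (PiLp.continuous_toLp 2 _).comp (continuous_pi fun i => ?_)
  fin_cases i
  · exact continuous_fst
  · exact continuous_snd

lemma continuous_toE2' {X : Type*} [TopologicalSpace X] {f g : X → ℝ} (hf : Continuous f)
    (hg : Continuous g) : Continuous fun z => (!₂[f z, g z] : E2) :=
  continuous_toE2.comp (hf.prodMk hg)

lemma continuous_fderiv_coord {F : E2 → E2} (hF : ContDiff ℝ 1 F) (v : E2) (i : Fin 2) :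
    Continuous fun ξ => fderiv ℝ F ξ v i :=
  (EuclideanSpace.proj (𝕜 := ℝ) i).continuous.comp
    ((hF.continuous_fderiv one_ne_zero).clm_apply continuous_const)

lemma continuous_div {F : E2 → E2} (hF : ContDiff ℝ 1 F) : Continuous (div F) :=
  (continuous_fderiv_coord hF _ 0).add (continuous_fderiv_coord hF _ 1)

lemma continuous_coord {F : E2 → E2} (hF : Continuous F) (i : Fin 2) :
    Continuous fun ξ => F ξ i :=
  (EuclideanSpace.proj (𝕜 := ℝ) i).continuous.comp hF

/-- The divergence theorem on the reference triangle. -/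
theorem setIntegral_div {F : E2 → E2} (hF : ContDiff ℝ 1 F) :
    ∫ ξ in refTriangle, div F ξ =
      ∑ e, normalSign e * ∫ t in (0 : ℝ)..1, inner ℝ (normal e) (F (edgePoint e t)) := by
  have hc0 := (continuous_fderiv_coord hF !₂[1, 0] 0)
  have hc1 := (continuous_fderiv_coord hF !₂[0, 1] 1)
  have hF0 := continuous_coord hF.continuous 0
  have hF1 := continuous_coord hF.continuous 1
  have hid : Continuous fun t : ℝ => t := continuous_id
  have i0 : ∫ z in prodTriangle, fderiv ℝ F !₂[z.1, z.2] !₂[1, 0] 0 =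
      (∫ t in (0 : ℝ)..1, F !₂[t, 1 - t] 0) - ∫ t in (0 : ℝ)..1, F !₂[0, t] 0 := by
    refine (setIntegral_prodTriangle_swap (hc0.comp continuous_toE2)).trans ?_
    simp only [Function.comp_apply]
    have h1 : ∀ y : ℝ, ∫ x in (0 : ℝ)..(1 - y), fderiv ℝ F !₂[x, y] !₂[1, 0] 0 =
        F !₂[1 - y, y] 0 - F !₂[0, y] 0 := fun y =>
      intervalIntegral.integral_eq_sub_of_hasDerivAt (f := fun x => F !₂[x, y] 0)
        (fun x _ => hasDerivAt_comp_fst hF x y)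
        ((hc0.comp (continuous_toE2' hid continuous_const)).intervalIntegrable _ _)
    -- Integrating in x first parametrizes the hypotenuse by y; the reflection t ↦ 1 - t restores
    -- the parametrization of the edge `e₂₃`.
    have h2 := intervalIntegral.integral_comp_sub_left (a := 0) (b := 1)
      (fun t : ℝ => F !₂[t, 1 - t] 0) 1
    simp only [sub_sub_cancel, sub_self, sub_zero] at h2
    simp only [h1]
    rw [intervalIntegral.integral_sub, h2]
    · exact (hF0.comp (continuous_toE2' (continuous_const.sub hid) hid)).intervalIntegrable _ _
    · exact (hF0.comp (continuous_toE2' continuous_const hid)).intervalIntegrable _ _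
  have i1 : ∫ z in prodTriangle, fderiv ℝ F !₂[z.1, z.2] !₂[0, 1] 1 =
      (∫ t in (0 : ℝ)..1, F !₂[t, 1 - t] 1) - ∫ t in (0 : ℝ)..1, F !₂[t, 0] 1 := by
    refine (setIntegral_prodTriangle (hc1.comp continuous_toE2)).trans ?_
    simp only [Function.comp_apply]
    have h1 : ∀ x : ℝ, ∫ y in (0 : ℝ)..(1 - x), fderiv ℝ F !₂[x, y] !₂[0, 1] 1 =
        F !₂[x, 1 - x] 1 - F !₂[x, 0] 1 := fun x =>
      intervalIntegral.integral_eq_sub_of_hasDerivAt (f := fun y => F !₂[x, y] 1)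
        (fun y _ => hasDerivAt_comp_snd hF x y)
        ((hc1.comp (continuous_toE2' continuous_const hid)).intervalIntegrable _ _)
    simp only [h1]
    rw [intervalIntegral.integral_sub]
    · exact (hF1.comp (continuous_toE2' hid (continuous_const.sub hid))).intervalIntegrable _ _
    · exact (hF1.comp (continuous_toE2' hid continuous_const)).intervalIntegrable _ _
  have h2 : ∫ t in (0 : ℝ)..1, inner ℝ (normal 2) (F (edgePoint 2 t)) =
      -(∫ t in (0 : ℝ)..1, F !₂[t, 1 - t] 0) - ∫ t in (0 : ℝ)..1, F !₂[t, 1 - t] 1 := by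
    rw [← intervalIntegral.integral_neg, ← intervalIntegral.integral_sub]
    · simp [inner_normal, edgePoint_two]
    · exact (hF0.comp (continuous_toE2' hid (continuous_const.sub hid))).neg.intervalIntegrable _ _
    · exact (hF1.comp (continuous_toE2' hid (continuous_const.sub hid))).intervalIntegrable _ _
  rw [setIntegral_refTriangle]
  simp only [div]
  rw [integral_add, i0, i1, Fin.sum_univ_three, h2]
  · simp [inner_normal, edgePoint_zero, edgePoint_one]
    ring
  · exact (hc0.comp continuous_toE2).continuousOn.integrableOn_compact isCompact_prodTriangle
  · exact (hc1.comp continuous_toE2).continuousOn.integrableOn_compact isCompact_prodTriangle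

/-! ### Integration over the cells of a mesh -/

/-- The interior of an element. -/
def Mesh.cell (K : Fin M.size) : Set E2 := M.map K '' interior refTriangle

lemma Mesh.map_nhds_eq (K : Fin M.size) {ξ : E2} (hξ : ξ ∈ refTriangle) :
    Filter.map (M.map K) (𝓝 ξ) = 𝓝 (M.map K ξ) := by
  have hs : HasStrictFDerivAt (M.map K) (((fderiv ℝ (M.map K) ξ).toContinuousLinearEquivOfDetNeZero
      (M.det_ne_zero K ξ hξ) : E2 ≃L[ℝ] E2) : E2 →L[ℝ] E2) ξ := by
    rw [ContinuousLinearMap.coe_toContinuousLinearEquivOfDetNeZero]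
    exact (M.contDiff K).contDiffAt.hasStrictFDerivAt one_ne_zero
  exact hs.map_nhds_eq_of_equiv

lemma Mesh.isOpen_cell (K : Fin M.size) : IsOpen (M.cell K) := by
  rw [isOpen_iff_mem_nhds]
  rintro _ ⟨ξ, hξ, rfl⟩
  rw [← M.map_nhds_eq K (interior_subset hξ)]
  exact image_mem_map (isOpen_interior.mem_nhds hξ)

lemma Mesh.pairwise_disjoint_cell : Pairwise (Function.onFun Disjoint M.cell) := by
  intro K L hKL
  rw [Function.onFun, Set.disjoint_left]
  rintro _ ⟨ξ, hξ, rfl⟩ ⟨ζ, hζ, h⟩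
  exact hKL (M.eq_of_mem_interior hξ (interior_subset hζ) h.symm)

lemma interior_refTriangle_ae_eq : interior refTriangle =ᵐ[volume] refTriangle :=
  interior_ae_eq_of_null_frontier (convex_refTriangle.addHaar_frontier volume)

/-- The boundary of the triangle is null by convexity, and differentiable maps of the plane send
null sets to null sets. -/
lemma Mesh.iUnion_cell_ae_eq : (⋃ K, M.cell K) =ᵐ[volume] closure A := by
  have hsub : (⋃ K, M.cell K) ⊆ closure A := by
    rw [M.closure_eq]
    exact Set.iUnion_mono fun K => Set.image_mono interior_subset
  refine hsub.eventuallyLE.antisymm (ae_le_set.2 ?_)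
  have hnull : volume (⋃ K, M.map K '' (refTriangle \ interior refTriangle)) = 0 := by
    refine measure_iUnion_null fun K => ?_
    refine addHaar_image_eq_zero_of_differentiableOn_of_addHaar_eq_zero volume
      ((M.contDiff K).differentiable one_ne_zero).differentiableOn ?_
    exact ae_le_set.1 interior_refTriangle_ae_eq.symm.le
  refine measure_mono_null ?_ hnull
  rintro x ⟨hx, hx'⟩
  rw [M.closure_eq, Set.mem_iUnion] at hx
  obtain ⟨K, ξ, hξ, rfl⟩ := hx
  refine Set.mem_iUnion.2 ⟨K, ξ, ⟨hξ, fun h => hx' (Set.mem_iUnion.2 ⟨K, ξ, h, rfl⟩)⟩, rfl⟩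

lemma Mesh.volume_cell_lt_top (K : Fin M.size) : volume (M.cell K) < ⊤ :=
  (measure_mono (Set.image_mono interior_subset)).trans_lt
    (isCompact_refTriangle.image (M.contDiff K).continuous).measure_lt_top

lemma Mesh.memLp_cell {F : Type*} [NormedAddCommGroup F] {f g : E2 → F} {K : Fin M.size}
    (hfg : ∀ ξ ∈ interior refTriangle, f (M.map K ξ) = g ξ) (hg : ContinuousOn g refTriangle)
    (r : ENNReal) : MemLp f r (volume.restrict (M.cell K)) := by
  have : IsFiniteMeasure (volume.restrict (M.cell K)) :=
    ⟨by simpa using M.volume_cell_lt_top K⟩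
  have hmeas := (M.isOpen_cell K).measurableSet
  have hc : ContinuousOn f (M.cell K) := by
    rintro _ ⟨ξ, hξ, rfl⟩
    refine ContinuousAt.continuousWithinAt ?_
    -- Neighbourhoods of an image point are the images of neighbourhoods, so continuity of `f` is
    -- continuity of its pullback.
    rw [ContinuousAt, ← M.map_nhds_eq K (interior_subset hξ), tendsto_map'_iff, hfg ξ hξ]
    have h1 : ContinuousAt g ξ := hg.continuousAt (mem_interior_iff_mem_nhds.1 hξ)
    refine h1.tendsto.congr' ?_
    filter_upwards [isOpen_interior.mem_nhds hξ] with ζ hζ using (hfg ζ hζ).symm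
  obtain ⟨C, hC⟩ := isCompact_refTriangle.exists_bound_of_continuousOn hg
  refine MemLp.of_bound (hc.aestronglyMeasurable hmeas) C ?_
  filter_upwards [ae_restrict_mem hmeas] with x hx
  obtain ⟨ξ, hξ, rfl⟩ := hx
  rw [hfg ξ hξ]
  exact hC ξ (interior_subset hξ)

lemma Mesh.memLp_of_forall_cell {F : Type*} [NormedAddCommGroup F] {f : E2 → F} {r : ENNReal}
    (h : ∀ K, MemLp f r (volume.restrict (M.cell K))) : MemLp f r (volume.restrict A) := by
  have h1 : MemLp (fun x => ∑ K, (M.cell K).indicator f x) r (volume.restrict (⋃ K, M.cell K)) :=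
    (memLp_finsetSum _ fun K _ => (memLp_indicator_iff_restrict
      (M.isOpen_cell K).measurableSet).2 (h K)).mono_measure Measure.restrict_le_self
  have h2 : MemLp f r (volume.restrict (⋃ K, M.cell K)) := by
    refine (memLp_congr_ae ?_).1 h1
    filter_upwards [ae_restrict_mem (isOpen_iUnion M.isOpen_cell).measurableSet] with x hx
    obtain ⟨K, hK⟩ := Set.mem_iUnion.1 hx
    rw [Finset.sum_eq_single K, Set.indicator_of_mem hK]
    · exact fun L _ hL =>
        Set.indicator_of_notMem ((M.pairwise_disjoint_cell hL.symm).notMem_of_mem_left hK) _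
    · simp
  rw [Measure.restrict_congr_set M.iUnion_cell_ae_eq] at h2
  exact h2.mono_measure (Measure.restrict_mono subset_closure le_rfl)

/-- The cells fill the closure of `A`, whose boundary may have positive measure; vanishing off `A`
is what makes both integrals equal. -/
lemma Mesh.setIntegral_eq_sum {f : E2 → ℝ} (h0 : ∀ x ∉ A, f x = 0)
    (h : ∀ K, IntegrableOn f (M.cell K)) : ∫ x in A, f x = ∑ K, ∫ x in M.cell K, f x := by
  rw [← setIntegral_eq_of_subset_of_forall_sdiff_eq_zero isClosed_closure.measurableSet
      subset_closure fun x hx => h0 x hx.2, ← setIntegral_congr_set M.iUnion_cell_ae_eq,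
    integral_iUnion_fintype (fun K => (M.isOpen_cell K).measurableSet) M.pairwise_disjoint_cell h]

/-- Cells are disjoint and element maps injective, so the preimage that is chosen is the given one.
Off the cells the value is 0. -/
lemma Mesh.exists_cellwise (h : Fin M.size → E2 → ℝ) :
    ∃ d : E2 → ℝ, ∀ K, ∀ ξ ∈ interior refTriangle, d (M.map K ξ) = h K ξ := by
  classical
  refine ⟨fun x => if hx : ∃ a : Fin M.size × E2, a.2 ∈ interior refTriangle ∧ M.map a.1 a.2 = x
    then h hx.choose.1 hx.choose.2 else 0, fun K ξ hξ => ?_⟩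
  have hx : ∃ a : Fin M.size × E2, a.2 ∈ interior refTriangle ∧ M.map a.1 a.2 = M.map K ξ :=
    ⟨(K, ξ), hξ, rfl⟩
  simp only [dif_pos hx]
  obtain ⟨h1, h2⟩ := hx.choose_spec
  have h3 := M.eq_of_mem_interior h1 (interior_subset hξ) h2
  rw [h3] at h2 ⊢
  rw [M.injOn K (interior_subset h1) (interior_subset hξ) h2]

/-! ### The divergence of a finite element function -/

lemma contDiff_fn {p : ℕ} (U : H1Basis p) (s : ScalarIdx p) : ContDiff ℝ 1 (U.fn s) := by
  unfold H1Basis.fn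
  induction U.base s using MvPolynomial.induction_on with
  | C a => simpa using contDiff_const
  | add P Q hP hQ => simpa using hP.add hQ
  | mul_X P i hP =>
    simpa using hP.mul (EuclideanSpace.proj (𝕜 := ℝ) i).contDiff

lemma contDiff_field {p : ℕ} (U : H1Basis p) (c : VecIdx p → ℝ) : ContDiff ℝ 1 (U.field c) :=
  ContDiff.sum fun b _ => (((contDiff_fn U b.1).smul contDiff_const).const_smul (c b) :
    ContDiff ℝ 1 fun ξ => c b • U.fn b.1 ξ • template b.1 b.2)

lemma div_smul {Q : E2 → ℝ} {φ : E2 → E2} (hQ : Differentiable ℝ Q) (hφ : Differentiable ℝ φ)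
    (ξ : E2) : div (fun ξ => Q ξ • φ ξ) ξ = fderiv ℝ Q ξ (φ ξ) + Q ξ * div φ ξ := by
  have h : fderiv ℝ Q ξ (φ ξ) = φ ξ 0 * fderiv ℝ Q ξ !₂[1, 0] + φ ξ 1 * fderiv ℝ Q ξ !₂[0, 1] := by
    conv_lhs => rw [e2_eq_smul (φ ξ)]
    simp
  rw [div, fderiv_fun_smul (hQ ξ) (hφ ξ), h, div]
  simp
  ring

lemma Mesh.continuousOn_piola (K : Fin M.size) {φ : E2 → E2} (hφ : Continuous φ) :
    ContinuousOn (piola (M.map K) φ) refTriangle :=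
  ((M.continuous_det K).continuousOn.inv₀ (M.det_ne_zero K)).smul
    ((M.continuous_fderiv K).clm_apply hφ).continuousOn

lemma Mesh.continuousOn_inv_det_mul_div (K : Fin M.size) {φ : E2 → E2} (hφ : ContDiff ℝ 1 φ) :
    ContinuousOn (fun ξ => (fderiv ℝ (M.map K) ξ).det⁻¹ * div φ ξ) refTriangle :=
  ((M.continuous_det K).continuousOn.inv₀ (M.det_ne_zero K)).mul (continuous_div hφ).continuousOn

/-- Green's formula for the Piola transform on an element. -/
lemma Mesh.setIntegral_cell (K : Fin M.size) {φ u : E2 → E2} {d q : E2 → ℝ}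
    (hφ : ContDiff ℝ 1 φ) (hq : ContDiff ℝ 1 q)
    (hu : ∀ ξ ∈ interior refTriangle, u (M.map K ξ) = piola (M.map K) φ ξ)
    (hd : ∀ ξ ∈ interior refTriangle,
      d (M.map K ξ) = (fderiv ℝ (M.map K) ξ).det⁻¹ * div φ ξ) :
    ∫ x in M.cell K, (fderiv ℝ q x (u x) + d x * q x) =
      ∑ e, M.side K e * ∫ t in (0 : ℝ)..1,
        q (M.map K (edgePoint e t)) * inner ℝ (normal e) (φ (edgePoint e t)) := by
  have hQ : ContDiff ℝ 1 (q ∘ M.map K) := hq.comp (M.contDiff K)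
  have hF : ContDiff ℝ 1 (fun ξ => (q ∘ M.map K) ξ • φ ξ) := hQ.smul hφ
  -- With Q = q ∘ x, the chain rule turns ⟨∇q, J φ⟩ into ⟨∇Q, φ⟩. Both summands carry 1/det J, so
  -- the Jacobian weight |det J| leaves only its sign times div (Q φ).
  have h1 : ∀ ξ ∈ interior refTriangle, |(fderiv ℝ (M.map K) ξ).det| •
      (fderiv ℝ q (M.map K ξ) (u (M.map K ξ)) + d (M.map K ξ) * q (M.map K ξ)) =
      M.orient K * div (fun ξ => (q ∘ M.map K) ξ • φ ξ) ξ := by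
    intro ξ hξ
    have hdet := M.det_ne_zero K ξ (interior_subset hξ)
    rw [div_smul (hQ.differentiable one_ne_zero) (hφ.differentiable one_ne_zero), hu ξ hξ,
      hd ξ hξ, M.abs_det K (interior_subset hξ), piola, fderiv_comp ξ
        (hq.differentiable one_ne_zero _) ((M.contDiff K).differentiable one_ne_zero _)]
    simp only [map_smul, smul_eq_mul, ContinuousLinearMap.comp_apply, Function.comp_apply]
    field_simp
  rw [Mesh.cell, integral_image_eq_integral_abs_det_fderiv_smul volume
      isOpen_interior.measurableSet (fun ξ _ => (M.hasFDerivAt K ξ).hasFDerivWithinAt)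
      ((M.injOn K).mono interior_subset),
    setIntegral_congr_fun isOpen_interior.measurableSet h1, integral_const_mul,
    setIntegral_congr_set interior_refTriangle_ae_eq, setIntegral_div hF, Finset.mul_sum]
  refine Finset.sum_congr rfl fun e _ => ?_
  simp only [Mesh.side, inner_smul_right, Function.comp_apply, mul_assoc]

/-- The boundary terms of the elements cancel. -/
lemma Mesh.IsAssembled.sum_boundary_eq_zero {M : Mesh A} (hA : IsOpen A) {p : ℕ} (U : H1Basis p)
    {c : Fin M.size → VecIdx p → ℝ} (hc : M.IsAssembled c) {q : E2 → ℝ} (hq : ∀ x ∉ A, q x = 0)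
    {t : ℝ} (ht : t ∈ Set.Ioo (0 : ℝ) 1) :
    ∑ a : Fin M.size × Edge, M.side a.1 a.2 * (q (M.map a.1 (edgePoint a.2 t)) *
      inner ℝ (normal a.2) (U.field (c a.1) (edgePoint a.2 t))) = 0 := by
  classical
  -- Element-edge pairs are grouped by mesh edge. Within a class, `q` and the normal projection are
  -- common factors, so the sides sum to zero if the point lies in `A`; otherwise `q` vanishes.
  let R : Setoid (Fin M.size × Edge) :=
    { r := fun b a => M.SameEdge a.1 b.1 a.2 b.2
      iseqv := ⟨fun _ => ⟨rfl, rfl⟩, fun h => ⟨h.1.symm, h.2.symm⟩,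
        fun h h' => ⟨h'.1.trans h.1, h'.2.trans h.2⟩⟩ }
  have ht' := Set.Ioo_subset_Icc_self ht
  refine Finset.sum_cancels_of_partition_cancels R fun a _ => ?_
  by_cases hx : M.map a.1 (edgePoint a.2 t) ∈ A
  · rw [← zero_mul (q (M.map a.1 (edgePoint a.2 t)) *
      inner ℝ (normal a.2) (U.field (c a.1) (edgePoint a.2 t))),
      ← M.sum_side_eq_zero hA a.1 a.2 ht hx, Finset.sum_mul]
    refine Finset.sum_congr rfl fun b hb => ?_
    have hb' : M.SameEdge a.1 b.1 a.2 b.2 := (Finset.mem_filter.1 hb).2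
    rw [hc.inner_normal_eq U hb' ht', M.edge_eq _ _ _ _ hb'.1 hb'.2 t ht']
  · refine Finset.sum_eq_zero fun b hb => ?_
    have hb' : M.SameEdge a.1 b.1 a.2 b.2 := (Finset.mem_filter.1 hb).2
    rw [← M.edge_eq _ _ _ _ hb'.1 hb'.2 t ht', hq _ hx]
    simp

lemma Mesh.bdmSpace_subset_Hdiv (hA : IsOpen A) {p : ℕ} (U : H1Basis p) :
    M.bdmSpace U ⊆ Hdiv A := by
  rintro u ⟨c, hc, hu⟩
  have hφ := fun K => contDiff_field U (c K)
  obtain ⟨d, hd⟩ := M.exists_cellwise fun K ξ =>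
    (fderiv ℝ (M.map K) ξ).det⁻¹ * div (U.field (c K)) ξ
  refine ⟨M.memLp_of_forall_cell fun K => M.memLp_cell (hu K)
      (M.continuousOn_piola K (hφ K).continuous) 2, d,
    M.memLp_of_forall_cell fun K => M.memLp_cell (hd K)
      (M.continuousOn_inv_det_mul_div K (hφ K)) 2, fun q hq _ hqA => ?_⟩
  have hq1 : ContDiff ℝ 1 q := hq.of_le (by exact_mod_cast le_top)
  have hq0 : ∀ x ∉ A, q x = 0 := fun x hx => image_eq_zero_of_notMem_tsupport fun h => hx (hqA h)
  have hi1 : ∀ K, MemLp (fun x => fderiv ℝ q x (u x)) 1 (volume.restrict (M.cell K)) := by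
    refine fun K => M.memLp_cell
      (g := fun ξ => fderiv ℝ q (M.map K ξ) (piola (M.map K) (U.field (c K)) ξ))
      (fun ξ hξ => by simp only [hu K ξ hξ]) ?_ 1
    exact ((hq1.continuous_fderiv one_ne_zero).comp
      (M.contDiff K).continuous).continuousOn.clm_apply
      (M.continuousOn_piola K (hφ K).continuous)
  have hi2 : ∀ K, MemLp (fun x => d x * q x) 1 (volume.restrict (M.cell K)) := by
    refine fun K => M.memLp_cell
      (g := fun ξ => (fderiv ℝ (M.map K) ξ).det⁻¹ * div (U.field (c K)) ξ * q (M.map K ξ))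
      (fun ξ hξ => by simp only [hd K ξ hξ]) ?_ 1
    exact (M.continuousOn_inv_det_mul_div K (hφ K)).mul
      (hq1.continuous.comp (M.contDiff K).continuous).continuousOn
  rw [eq_neg_iff_add_eq_zero, ← integral_add
    (memLp_one_iff_integrable.1 (M.memLp_of_forall_cell hi1))
    (memLp_one_iff_integrable.1 (M.memLp_of_forall_cell hi2)), M.setIntegral_eq_sum]
  · have hint : ∀ a : Fin M.size × Edge, IntervalIntegrable (fun t => M.side a.1 a.2 *
        (q (M.map a.1 (edgePoint a.2 t)) *
          inner ℝ (normal a.2) (U.field (c a.1) (edgePoint a.2 t)))) volume 0 1 := by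
      intro a
      refine Continuous.intervalIntegrable ?_ _ _
      exact continuous_const.mul ((hq1.continuous.comp ((M.contDiff a.1).continuous.comp
        (continuous_edgePoint a.2))).mul (continuous_const.inner
          ((hφ a.1).continuous.comp (continuous_edgePoint a.2))))
    calc ∑ K, ∫ x in M.cell K, (fderiv ℝ q x (u x) + d x * q x)
        = ∑ a : Fin M.size × Edge, ∫ t in (0 : ℝ)..1, M.side a.1 a.2 *
            (q (M.map a.1 (edgePoint a.2 t)) *
              inner ℝ (normal a.2) (U.field (c a.1) (edgePoint a.2 t))) := by
          rw [Fintype.sum_prod_type]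
          refine Finset.sum_congr rfl fun K _ => ?_
          rw [M.setIntegral_cell K (hφ K) hq1 (hu K) (hd K)]
          simp only [intervalIntegral.integral_const_mul]
      _ = ∫ t in (0 : ℝ)..1, ∑ a : Fin M.size × Edge, M.side a.1 a.2 *
            (q (M.map a.1 (edgePoint a.2 t)) *
              inner ℝ (normal a.2) (U.field (c a.1) (edgePoint a.2 t))) :=
          (intervalIntegral.integral_finsetSum fun a _ => hint a).symm
      _ = 0 := by
          -- Cancellation is known only away from the mesh vertices; the endpoint dropped here is a
          -- null set.
          rw [intervalIntegral.integral_of_le zero_le_one, integral_Ioc_eq_integral_Ioo]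
          exact setIntegral_eq_zero_of_forall_eq_zero fun t ht =>
            hc.sum_boundary_eq_zero hA U hq0 ht
  · intro x hx
    rw [hq0 x hx, fderiv_of_notMem_tsupport ℝ fun h => hx (hqA h)]
    simp
  · exact fun K => (memLp_one_iff_integrable.1 (hi1 K)).add (memLp_one_iff_integrable.1 (hi2 K))

end BDMTriangle

theorem mainTheorem6 (p : ℕ) (hp : 1 ≤ p) (U : H1Basis p) :
    -- every non-cell base function belongs to exactly one edge
    (∀ b : VecIdx p, ¬ IsCellFunction b → ∃! e, IsEdgeFunction b e) ∧
    -- its normal projection on that edge is the scalar base function, on the other edges zero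
    (∀ (b : VecIdx p) (e : Edge), IsEdgeFunction b e →
      (∀ ξ ∈ refEdge e, inner ℝ (normal e) (U.bdm b ξ) = U.fn b.1 ξ) ∧
      (∀ e', e' ≠ e → ∀ ξ ∈ refEdge e', inner ℝ (normal e') (U.bdm b ξ) = 0)) ∧
    -- cell base functions have zero normal projection on all edges
    (∀ b : VecIdx p, IsCellFunction b →
      ∀ e, ∀ ξ ∈ refEdge e, inner ℝ (normal e) (U.bdm b ξ) = 0) ∧
    ∀ (A : Set E2), IsOpen A → ∀ M : Mesh A,
      -- the normal projections are maintained by the contravariant Piola transformation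
      (∀ (K : Fin M.size) (b : VecIdx p) (e : Edge), ∀ ξ ∈ refEdge e,
        inner ℝ (rot (fderiv ℝ (M.map K) ξ (tangent e))) (piola (M.map K) (U.bdm b) ξ) =
          inner ℝ (normal e) (U.bdm b ξ)) ∧
      -- the normal components of a finite element function do not jump across interfaces
      (∀ c : Fin M.size → VecIdx p → ℝ, M.IsAssembled c →
        ∀ K L e e', M.SameEdge K L e e' → ∀ t ∈ Set.Icc (0 : ℝ) 1,
        ∀ n : E2, inner ℝ n (fderiv ℝ (M.map K) (edgePoint e t) (tangent e)) = 0 →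
          inner ℝ n (piola (M.map K) (U.field (c K)) (edgePoint e t)) =
            inner ℝ n (piola (M.map L) (U.field (c L)) (edgePoint e' t))) ∧
      -- the finite element space is a subspace of `H(div, A)`
      M.bdmSpace U ⊆ Hdiv A := by
  refine ⟨fun b hb => existsUnique_isEdgeFunction hb, fun b e hb => ⟨fun ξ _ =>
    inner_normal_bdm_of_isEdgeFunction U hb ξ, fun e' he' ξ hξ =>
    inner_normal_bdm_of_not_isEdgeFunction U (fun hb' => he' ?_) hξ⟩, fun b hb e ξ hξ =>
    inner_normal_bdm_of_not_isEdgeFunction U (not_isEdgeFunction_of_isCellFunction hb e) hξ,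
    fun A hA M => ⟨fun K b e ξ hξ => inner_rot_piola _ (M.det_ne_zero K ξ (refEdge_subset e hξ)) _,
      fun c hc K L e e' h t ht n hn => hc.inner_piola_eq U h ht hn, M.bdmSpace_subset_Hdiv hA U⟩⟩
  exact (existsUnique_isEdgeFunction (not_isCellFunction_of_isEdgeFunction hb)).unique hb' hb
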